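/- Let $d_{\rm out},d_{\rm in},m,r,s$ be natural numbers with $1\le r\le s<d_{\rm in}$. Let $Q\in\mathbb R^{d_{\rm out}\times m}$, and let $H\in\mathbb R^{d_{\rm in}\times m}$ have rank $s$ and compact singular value decomposition $H=U\,\mathrm{diag}(\sigma_1,\dots,\sigma_s)\,V^\top$, where $U^\top U=V^\top V=I_s$ and $\sigma_1\ge\dots\ge\sigma_s>0$. Let the layer gradient $G=QH^\top$ be nonzero, let $A\in\mathbb R^{d_{\rm in}\times r}$ consist of the first $r$ columns of $U$ (the top-$r$ left singular vectors of $H$), and let $B=V^\top Q^\top QV$. Write $\langle X,Y\rangle_F=\mathrm{tr}(X^\top Y)$, $\|X\|_F=\langle X,X\rangle_F^{1/2}$ and $\cos(X,Y)=\langle X,Y\rangle_F/(\|X\|_F\|Y\|_F)$. The noiseless AGZO estimator is $\widehat G_0^{\rm AGZO}=\langle G,RA^\top\rangle_F\,RA^\top$, where $R\in\mathbb R^{d_{\rm out}\times r}$ has i.i.d. standard normal entries; the noiseless MeZO estimator is $\widehat G_0^{\rm MEZO}=\langle G,R\rangle_F\,R$, where $R\in\mathbb R^{d_{\rm out}\times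 d_{\rm in}}$ has i.i.d. standard normal entries. Assume $$\frac1r\sum_{i=1}^r B_{ii}\ \ge\ \frac1s\sum_{i=1}^s B_{ii}.$$ Then: 1. $$\frac{\sum_{i=1}^r B_{ii}\sigma_i^2}{\sum_{i=1}^s B_{ii}\sigma_i^2}\ \ge\ \frac rs\ \ge\ \frac r{d_{\rm in}-1/d_{\rm out}},$$ and the first inequality is strict if $r<s$ and $\sigma_r>\sigma_{r+1}$. 2. Both cosine similarities below are integrable, and $$\mathbb E_R\big[\cos(\widehat G_0^{\rm AGZO},G)\big]\ >\ \mathbb E_R\big[\cos(\widehat G_0^{\rm MEZO},G)\big].$$ 3. The gap $\mathbb E_R[\cos(\widehat G_0^{\rm AGZO},G)]-\mathbb E_R[\cos(\widehat G_0^{\rm MEZO},G)]$ widens as the singular values become more heterogeneous: if $U,V,Q$ are kept and $\sigma$ is replaced by positive non-increasing $\tau_1,\dots,\tau_s$ that decay at least as fast, i.e. $\tau_j/\tau_i\le\sigma_j/\sigma_i$ for all $i\le j$, then the gap does not decrease, and it strictly increases if $\tau_j/\tau_i<\sigma_j/\sigma_i$ for some $i\le r<j$ with $B_{ii}>0$ and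 $B_{jj}>0$. -/

import Mathlib

open MeasureTheory ProbabilityTheory

noncomputable section

namespace AGZO

/-- The Frobenius inner product `tr(Xᵀ Y)`. -/
def frobInner {p q : ℕ} (X Y : Matrix (Fin p) (Fin q) ℝ) : ℝ :=
  (X.transpose * Y).trace

/-- The Frobenius norm. -/
def frobNorm {p q : ℕ} (X : Matrix (Fin p) (Fin q) ℝ) : ℝ :=
  Real.sqrt (frobInner X X)

/-- Cosine similarity of two matrices for the Frobenius inner product. -/
def cosSim {p q : ℕ} (X Y : Matrix (Fin p) (Fin q) ℝ) : ℝ :=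
  frobInner X Y / (frobNorm X * frobNorm Y)

/-- The noiseless single-query zeroth-order estimator for the gradient `G` and the
perturbation `Δ`: the exact directional derivative `⟨G, Δ⟩` times `Δ`. -/
def noiselessEstimator {p q : ℕ} (G Δ : Matrix (Fin p) (Fin q) ℝ) :
    Matrix (Fin p) (Fin q) ℝ :=
  frobInner G Δ • Δ

/-- The noiseless AGZO estimator: the perturbation is `R Aᵀ`. -/
def agzoEstimator {p q r : ℕ} (G : Matrix (Fin p) (Fin q) ℝ) (A : Matrix (Fin q) (Fin r) ℝ)
    (R : Matrix (Fin p) (Fin r) ℝ) : Matrix (Fin p) (Fin q) ℝ :=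
  noiselessEstimator G (R * A.transpose)

/-- The noiseless MeZO estimator: the perturbation is the dense matrix `R`. -/
def mezoEstimator {p q : ℕ} (G R : Matrix (Fin p) (Fin q) ℝ) : Matrix (Fin p) (Fin q) ℝ :=
  noiselessEstimator G R

/-- The law of a `p × q` array of independent standard normal entries. -/
def gaussianEntries (p q : ℕ) : Measure (Fin p → Fin q → ℝ) :=
  Measure.pi fun _ => Measure.pi fun _ => gaussianReal 0 1

/-- Expected cosine similarity of the noiseless AGZO estimator with the gradient. -/
def agzoExpectedCos {p q r : ℕ} (G : Matrix (Fin p) (Fin q) ℝ)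
    (A : Matrix (Fin q) (Fin r) ℝ) : ℝ :=
  ∫ R, cosSim (agzoEstimator G A (Matrix.of R)) G ∂(gaussianEntries p r)

/-- Expected cosine similarity of the noiseless MeZO estimator with the gradient. -/
def mezoExpectedCos {p q : ℕ} (G : Matrix (Fin p) (Fin q) ℝ) : ℝ :=
  ∫ R, cosSim (mezoEstimator G (Matrix.of R)) G ∂(gaussianEntries p q)

/-- The gap in expected cosine similarity between AGZO and MeZO. -/
def cosGap {p q r : ℕ} (G : Matrix (Fin p) (Fin q) ℝ) (A : Matrix (Fin q) (Fin r) ℝ) : ℝ :=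
  agzoExpectedCos G A - mezoExpectedCos G

/-- `H = U diag(σ) Vᵀ` is a compact singular value decomposition: orthonormal columns,
positive singular values in non-increasing order (so `s` is the rank of `H`). -/
structure IsCompactSVD {d m s : ℕ} (H : Matrix (Fin d) (Fin m) ℝ)
    (U : Matrix (Fin d) (Fin s) ℝ) (σ : Fin s → ℝ) (V : Matrix (Fin m) (Fin s) ℝ) : Prop where
  eq : H = U * Matrix.diagonal σ * V.transpose
  left_orthonormal : U.transpose * U = 1
  right_orthonormal : V.transpose * V = 1
  pos : ∀ i, 0 < σ i
  anti : Antitone σ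

/-- The matrix formed by the first `r` columns. -/
def firstCols {d s r : ℕ} (U : Matrix (Fin d) (Fin s) ℝ) (hrs : r ≤ s) :
    Matrix (Fin d) (Fin r) ℝ :=
  U.submatrix id (Fin.castLE hrs)

/-- The interaction matrix `Vᵀ Qᵀ Q V`. -/
def interaction {p m s : ℕ} (Q : Matrix (Fin p) (Fin m) ℝ) (V : Matrix (Fin m) (Fin s) ℝ) :
    Matrix (Fin s) (Fin s) ℝ :=
  V.transpose * Q.transpose * Q * V

/-- Fraction of the energy `∑ Bᵢᵢ σᵢ²` that is carried by the first `r` directions. -/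
def energyShare {s r : ℕ} (B : Matrix (Fin s) (Fin s) ℝ) (σ : Fin s → ℝ) (hrs : r ≤ s) : ℝ :=
  (∑ i : Fin r, B (Fin.castLE hrs i) (Fin.castLE hrs i) * σ (Fin.castLE hrs i) ^ 2) /
    ∑ i : Fin s, B i i * σ i ^ 2

/-- `τ` is at least as heterogeneous as `σ`: it decays at least as fast, in the sense that every
ratio of a later to an earlier value is at most the corresponding ratio for `σ`. -/
def DecaysFaster {s : ℕ} (τ σ : Fin s → ℝ) : Prop :=
  ∀ i j : Fin s, i ≤ j → τ j / τ i ≤ σ j / σ i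

end AGZO

end

/-! For an estimator `⟨G, Δ⟩ Δ` the cosine with `G` is `|⟨G, Δ⟩| / (‖Δ‖ ‖G‖)`. With `Δ = R Aᵀ` and
`AᵀA = 1` one has `⟨G, R Aᵀ⟩ = ⟨GA, R⟩` and `‖R Aᵀ‖ = ‖R‖`, so both expectations reduce to `E |⟨g,
x⟩| / ‖x‖` for a standard Gaussian vector `x` in dimension `n`. Rotation invariance and Fubini give
`‖g‖ c / ν(n)`, where `c = meanAbs` and `ν = meanNorm` (`integral_abs_inner_div_norm_mul_meanNorm`);
no explicit Gamma function values are needed.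

Hence MeZO has the value `c / ν(dout * din)`, independent of `G`, and AGZO has `√ρ c / ν(dout * r)`
with `ρ = ‖GA‖² / ‖G‖²` equal to the energy share. The mean hypothesis on `B` and the ordering of
`σ` give `ρ ≥ r / s`. Since `ν(n) / √n` is nondecreasing, `√(r / s) / ν(dout * r) ≥ 1 / ν(dout *
s)`, and this exceeds `1 / ν(dout * din)` because `s < din`.

In the gap only `ρ` depends on the singular values, so the last claim is monotonicity of the energy
share, which follows by comparing pairs of one head index and one tail index. -/

namespace AGZO

/-! ### Expectation of `|⟨g, x⟩| / ‖x‖` under a standard Gaussian -/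

section StdGaussian

open scoped RealInnerProductSpace

variable {E : Type*} [NormedAddCommGroup E] [InnerProductSpace ℝ E] [FiniteDimensional ℝ E]
  [MeasurableSpace E] [BorelSpace E]

/-- The expected norm of a standard Gaussian vector in dimension `n`. -/
noncomputable def meanNorm (n : ℕ) : ℝ :=
  ∫ x, ‖x‖ ∂(stdGaussian (EuclideanSpace ℝ (Fin n)))

/-- The expected absolute value of a standard normal variable. -/
noncomputable def meanAbs : ℝ := ∫ x, |x| ∂(gaussianReal 0 1)

lemma integral_comp_linearIsometryEquiv_stdGaussian {F : Type*} [NormedAddCommGroup F]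
    [InnerProductSpace ℝ F] [FiniteDimensional ℝ F] [MeasurableSpace F] [BorelSpace F]
    (e : E ≃ₗᵢ[ℝ] F) (f : F → ℝ) :
    ∫ x, f (e x) ∂(stdGaussian E) = ∫ y, f y ∂(stdGaussian F) := by
  rw [← stdGaussian_map e]
  exact (integral_map_equiv e.toHomeomorph.toMeasurableEquiv f).symm

lemma integral_norm_stdGaussian :
    ∫ x, ‖x‖ ∂(stdGaussian E) = meanNorm (Module.finrank ℝ E) := by
  rw [meanNorm, ← integral_comp_linearIsometryEquiv_stdGaussian (stdOrthonormalBasis ℝ E).repr]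
  simp

lemma integrable_norm_stdGaussian : Integrable (fun x : E => ‖x‖) (stdGaussian E) :=
  (IsGaussian.integrable_id (μ := stdGaussian E)).norm

lemma map_inner_stdGaussian (g : E) :
    (stdGaussian E).map (fun x => ⟪g, x⟫) = (gaussianReal 0 1).map (‖g‖ * ·) := by
  have h := IsGaussian.map_eq_gaussianReal (μ := stdGaussian E) (innerSL ℝ g)
  rw [integral_strongDual_stdGaussian, variance_dual_stdGaussian, innerSL_apply_norm] at h
  rw [gaussianReal_map_const_mul]
  refine Eq.trans h ?_
  congr 1
  · simp
  · ext; simp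

lemma integral_abs_inner_stdGaussian (g : E) :
    ∫ x, |⟪g, x⟫| ∂(stdGaussian E) = ‖g‖ * meanAbs := by
  have h := integral_map (μ := stdGaussian E) (φ := fun x => ⟪g, x⟫) (f := fun t : ℝ => |t|)
    (by fun_prop) (by fun_prop)
  rw [← h, map_inner_stdGaussian, integral_map (by fun_prop) (by fun_prop), meanAbs,
    ← integral_const_mul]
  simp [abs_mul]

lemma meanAbs_pos : 0 < meanAbs := by
  have hi : Integrable (fun x : ℝ => |x|) (gaussianReal 0 1) :=
    (IsGaussian.integrable_id (μ := gaussianReal 0 1)).norm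
  rw [meanAbs, integral_pos_iff_support_of_nonneg (fun x => abs_nonneg x) hi]
  have : Function.support (fun x : ℝ => |x|) = {0}ᶜ := by ext; simp
  rw [this]
  have := nullSingletonClass_gaussianReal (μ := 0) (v := 1) one_ne_zero
  rw [prob_compl_eq_one_sub (by simp)]
  simp

lemma ae_ne_zero_stdGaussian [Nontrivial E] : ∀ᵐ x ∂(stdGaussian E), x ≠ 0 := by
  obtain ⟨e, he⟩ := exists_ne (0 : E)
  -- The origin lies in the hyperplane orthogonal to `e`, which is null because a nondegenerate real
  -- Gaussian has no atoms.
  have h0 : (stdGaussian E).map (fun x => ⟪e, x⟫) {0} = 0 := by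
    have := nullSingletonClass_gaussianReal (μ := 0) (v := 1) one_ne_zero
    rw [map_inner_stdGaussian, Measure.map_apply (by fun_prop) (by simp)]
    have : (fun x : ℝ => ‖e‖ * x) ⁻¹' {0} = {0} := by ext; simp [he]
    rw [this]
    simp
  rw [Measure.map_apply (by fun_prop) (by simp)] at h0
  rw [ae_iff]
  refine measure_mono_null ?_ h0
  intro x hx
  simp only [ne_eq, not_not, Set.mem_ofPred_eq] at hx
  simp [hx]

lemma meanNorm_pos {n : ℕ} (hn : 1 ≤ n) : 0 < meanNorm n := by
  have : NeZero n := ⟨by omega⟩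
  let e : EuclideanSpace ℝ (Fin n) := EuclideanSpace.single 0 1
  have he : ‖e‖ = 1 := by simp [e]
  have h := integral_abs_inner_stdGaussian e
  rw [he, one_mul] at h
  refine lt_of_lt_of_le meanAbs_pos ?_
  rw [← h, meanNorm]
  refine integral_mono_of_nonneg (Filter.Eventually.of_forall fun x => abs_nonneg _)
    integrable_norm_stdGaussian (Filter.Eventually.of_forall fun x => ?_)
  simpa [he] using abs_real_inner_le_norm e x

lemma integral_abs_inner_div_norm_eq_of_norm_eq {g g' : E} (h : ‖g‖ = ‖g'‖) :
    ∫ x, |⟪g, x⟫| / ‖x‖ ∂(stdGaussian E) = ∫ x, |⟪g', x⟫| / ‖x‖ ∂(stdGaussian E) := by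
  -- Reflection in the hyperplane orthogonal to `g - g'` exchanges two vectors of equal norm and
  -- preserves the Gaussian law.
  let e : E ≃ₗᵢ[ℝ] E := (Submodule.span ℝ {g - g'})ᗮ.reflection
  have he : e g = g' := Submodule.reflection_sub h
  rw [← he, ← integral_comp_linearIsometryEquiv_stdGaussian e fun x => |⟪e g, x⟫| / ‖x‖]
  simp

omit [BorelSpace E] in
lemma integral_abs_inner_smul_div_norm {c : ℝ} (hc : 0 ≤ c) (g : E) :
    ∫ x, |⟪c • g, x⟫| / ‖x‖ ∂(stdGaussian E) = c * ∫ x, |⟪g, x⟫| / ‖x‖ ∂(stdGaussian E) := by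
  rw [← integral_const_mul]
  congr with x
  rw [real_inner_smul_left, abs_mul, abs_of_nonneg hc, mul_div_assoc]

omit [FiniteDimensional ℝ E] [MeasurableSpace E] [BorelSpace E] in
lemma abs_inner_div_norm_le (g x : E) : |⟪g, x⟫| / ‖x‖ ≤ ‖g‖ :=
  div_le_of_le_mul₀ (norm_nonneg _) (norm_nonneg _) (abs_real_inner_le_norm g x)

lemma integrable_abs_inner_div_norm (g : E) :
    Integrable (fun x => |⟪g, x⟫| / ‖x‖) (stdGaussian E) := by
  refine Integrable.of_bound (Measurable.aestronglyMeasurable (by fun_prop)) ‖g‖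
    (Filter.Eventually.of_forall fun x => ?_)
  rw [Real.norm_of_nonneg (by positivity)]
  exact abs_inner_div_norm_le g x

/-- Replace `g` by an independent standard Gaussian `y` and integrate `|⟨y, x⟩| / ‖x‖` in both
orders. Over `x` first, the inner integral is proportional to `‖y‖`, which produces `meanNorm`; over
`y` first, it is `meanAbs` for every `x ≠ 0`. -/
lemma integral_abs_inner_div_norm_mul_meanNorm (g : E) :
    (∫ x, |⟪g, x⟫| / ‖x‖ ∂(stdGaussian E)) * meanNorm (Module.finrank ℝ E) = ‖g‖ * meanAbs := by
  by_cases hg : g = 0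
  · simp [hg]
  have : Nontrivial E := ⟨g, 0, hg⟩
  have hscale (y : E) : ‖g‖ * ∫ x, |⟪y, x⟫| / ‖x‖ ∂(stdGaussian E) =
      ‖y‖ * ∫ x, |⟪g, x⟫| / ‖x‖ ∂(stdGaussian E) := by
    rw [← integral_abs_inner_smul_div_norm (norm_nonneg _),
      ← integral_abs_inner_smul_div_norm (norm_nonneg _)]
    apply integral_abs_inner_div_norm_eq_of_norm_eq
    simp [norm_smul, mul_comm]
  have hint : Integrable (Function.uncurry fun y x : E => |⟪y, x⟫| / ‖x‖)
      ((stdGaussian E).prod (stdGaussian E)) := by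
    refine (integrable_norm_stdGaussian.comp_fst (stdGaussian E)).mono
      (Measurable.aestronglyMeasurable ?_) (Filter.Eventually.of_forall fun p => ?_)
    · unfold Function.uncurry
      fun_prop
    · rw [norm_norm, Real.norm_of_nonneg (by unfold Function.uncurry; positivity)]
      exact abs_inner_div_norm_le p.1 p.2
  have hswap := integral_integral_swap hint
  have hright : ∫ x, ∫ y, |⟪y, x⟫| / ‖x‖ ∂(stdGaussian E) ∂(stdGaussian E) = meanAbs := by
    have : (fun x : E => ∫ y, |⟪y, x⟫| / ‖x‖ ∂(stdGaussian E)) =ᵐ[stdGaussian E]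
        fun _ => meanAbs := by
      filter_upwards [ae_ne_zero_stdGaussian (E := E)] with x hx
      rw [integral_div]
      simp_rw [real_inner_comm x]
      rw [integral_abs_inner_stdGaussian]
      field_simp [norm_ne_zero_iff.2 hx]
    rw [integral_congr_ae this]
    simp
  rw [hright] at hswap
  rw [← hswap, ← integral_const_mul]
  simp_rw [hscale]
  rw [integral_mul_const, integral_norm_stdGaussian, mul_comm]

end StdGaussian

/-! ### Growth of the mean Gaussian norm with the dimension -/

lemma integral_sqrt_sum_sq_pi (n : ℕ) :
    ∫ x : Fin n → ℝ, √(∑ i, x i ^ 2) ∂(Measure.pi fun _ => gaussianReal 0 1) = meanNorm n := by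
  rw [meanNorm, ← map_pi_eq_stdGaussian, integral_map (by fun_prop) (by fun_prop)]
  simp [EuclideanSpace.norm_eq]

lemma integrable_sqrt_sum_sq_pi (n : ℕ) :
    Integrable (fun x : Fin n → ℝ => √(∑ i, x i ^ 2)) (Measure.pi fun _ => gaussianReal 0 1) := by
  have h := integrable_norm_stdGaussian (E := EuclideanSpace ℝ (Fin n))
  rw [← map_pi_eq_stdGaussian, integrable_map_measure (by fun_prop) (by fun_prop)] at h
  refine h.congr (Filter.Eventually.of_forall fun x => ?_)
  simp [EuclideanSpace.norm_eq]

lemma measurePreserving_comp_succAbove (n : ℕ) (i : Fin (n + 1)) :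
    MeasurePreserving (fun (x : Fin (n + 1) → ℝ) j => x (i.succAbove j))
      (Measure.pi fun _ => gaussianReal 0 1) (Measure.pi fun _ => gaussianReal 0 1) :=
  measurePreserving_snd.comp
    (measurePreserving_piFinSuccAbove (fun _ : Fin (n + 1) => gaussianReal 0 1) i)

/-- Cauchy–Schwarz over the `n + 1` coordinate deletions: each squared coordinate survives in `n` of
them, so the squared norms add up to `n ‖x‖²`. -/
lemma sum_sqrt_sum_sq_succAbove_le (n : ℕ) (x : Fin (n + 1) → ℝ) :
    ∑ i : Fin (n + 1), √(∑ j, x (i.succAbove j) ^ 2) ≤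
      √((n + 1) * n) * √(∑ i, x i ^ 2) := by
  rw [← Real.sqrt_mul (by positivity)]
  apply Real.le_sqrt_of_sq_le
  refine (sq_sum_le_card_mul_sum_sq).trans (le_of_eq ?_)
  have h (i : Fin (n + 1)) : √(∑ j, x (i.succAbove j) ^ 2) ^ 2 = ∑ k, x k ^ 2 - x i ^ 2 := by
    rw [Real.sq_sqrt (by positivity), Fin.sum_univ_succAbove _ i]
    ring
  simp_rw [h, Finset.sum_sub_distrib]
  simp
  ring

/-- Deleting a coordinate of a standard Gaussian vector leaves a standard Gaussian vector, so each
deletion has mean norm `meanNorm n`. This is one step of the monotonicity of `ν(n) / √n`. -/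
lemma succ_mul_meanNorm_le (n : ℕ) :
    (n + 1) * meanNorm n ≤ √((n + 1) * n) * meanNorm (n + 1) := by
  have hi (i : Fin (n + 1)) := (measurePreserving_comp_succAbove n i).integrable_comp_of_integrable
    (integrable_sqrt_sum_sq_pi n)
  simp only [Function.comp_def] at hi
  have he (i : Fin (n + 1)) :
      ∫ x : Fin (n + 1) → ℝ, √(∑ j, x (i.succAbove j) ^ 2)
        ∂(Measure.pi fun _ => gaussianReal 0 1) = meanNorm n := by
    rw [← integral_sqrt_sum_sq_pi, ← (measurePreserving_comp_succAbove n i).map_eq,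
      integral_map (measurePreserving_comp_succAbove n i).aemeasurable
        (Measurable.aestronglyMeasurable (by fun_prop))]
  calc (n + 1) * meanNorm n
      = ∫ x : Fin (n + 1) → ℝ, ∑ i : Fin (n + 1), √(∑ j, x (i.succAbove j) ^ 2)
        ∂(Measure.pi fun _ => gaussianReal 0 1) := by
        rw [integral_finsetSum _ fun i _ => hi i]
        simp [he]
    _ ≤ ∫ x : Fin (n + 1) → ℝ, √((n + 1) * n) * √(∑ i, x i ^ 2)
        ∂(Measure.pi fun _ => gaussianReal 0 1) :=
        integral_mono (integrable_finsetSum _ fun i _ => hi i)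
          ((integrable_sqrt_sum_sq_pi _).const_mul _) (sum_sqrt_sum_sq_succAbove_le n)
    _ = _ := by rw [integral_const_mul, integral_sqrt_sum_sq_pi]

lemma meanNorm_div_sqrt_mono {k n : ℕ} (hk : 1 ≤ k) (hkn : k ≤ n) :
    meanNorm k / √k ≤ meanNorm n / √n := by
  induction n, hkn using Nat.le_induction with
  | base => exact le_rfl
  | succ n hn ih =>
    refine ih.trans ?_
    have hn0 : (0 : ℝ) < n := by exact_mod_cast (by omega : 0 < n)
    have h := succ_mul_meanNorm_le n
    rw [Real.sqrt_mul (by positivity)] at h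
    rw [div_le_div_iff₀ (by positivity) (by positivity)]
    push_cast
    have hs : (0 : ℝ) < √(n + 1) := by positivity
    refine le_of_mul_le_mul_left ?_ hs
    have hq : √((n : ℝ) + 1) * √((n : ℝ) + 1) = n + 1 := Real.mul_self_sqrt (by positivity)
    calc √((n : ℝ) + 1) * (meanNorm n * √((n : ℝ) + 1))
        = √((n : ℝ) + 1) * √((n : ℝ) + 1) * meanNorm n := by ring
      _ ≤ √((n : ℝ) + 1) * √n * meanNorm (n + 1) := by rw [hq]; exact h
      _ = _ := by ring

lemma meanNorm_strictMono {k n : ℕ} (hk : 1 ≤ k) (hkn : k < n) : meanNorm k < meanNorm n := by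
  have h := meanNorm_div_sqrt_mono hk hkn.le
  have hk0 : (0 : ℝ) < √k := Real.sqrt_pos.2 (by exact_mod_cast hk)
  have hlt : √(k : ℝ) < √n := Real.sqrt_lt_sqrt (by positivity) (by exact_mod_cast hkn)
  rw [div_le_div_iff₀ hk0 (hk0.trans hlt)] at h
  have := mul_lt_mul_of_pos_left hlt (meanNorm_pos hk)
  exact lt_of_mul_lt_mul_right (this.trans_le h) hk0.le

end AGZO

namespace AGZO

/-! ### Frobenius geometry and the cosine of an estimator -/

section Frobenius

variable {p q : ℕ}

lemma frobInner_eq_sum (X Y : Matrix (Fin p) (Fin q) ℝ) :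
    frobInner X Y = ∑ ij : Fin p × Fin q, X ij.1 ij.2 * Y ij.1 ij.2 := by
  rw [frobInner, Matrix.trace, Fintype.sum_prod_type, Finset.sum_comm]
  simp [Matrix.mul_apply]

lemma frobInner_comm (X Y : Matrix (Fin p) (Fin q) ℝ) : frobInner X Y = frobInner Y X := by
  simp only [frobInner_eq_sum, mul_comm]

lemma frobInner_self_nonneg (X : Matrix (Fin p) (Fin q) ℝ) : 0 ≤ frobInner X X := by
  rw [frobInner_eq_sum]
  exact Finset.sum_nonneg fun _ _ => mul_self_nonneg _

lemma frobInner_self_pos {X : Matrix (Fin p) (Fin q) ℝ} (hX : X ≠ 0) : 0 < frobInner X X := by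
  refine lt_of_le_of_ne (frobInner_self_nonneg X) fun h => hX ?_
  rw [frobInner_eq_sum, eq_comm, Finset.sum_eq_zero_iff_of_nonneg fun _ _ => mul_self_nonneg _] at h
  ext i j
  simpa using h (i, j)

lemma frobNorm_pos {X : Matrix (Fin p) (Fin q) ℝ} (hX : X ≠ 0) : 0 < frobNorm X :=
  Real.sqrt_pos.2 (frobInner_self_pos hX)

lemma frobInner_smul_left (c : ℝ) (X Y : Matrix (Fin p) (Fin q) ℝ) :
    frobInner (c • X) Y = c * frobInner X Y := by
  simp [frobInner]

lemma frobNorm_smul (c : ℝ) (X : Matrix (Fin p) (Fin q) ℝ) :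
    frobNorm (c • X) = |c| * frobNorm X := by
  rw [frobNorm, frobInner_smul_left, frobInner_comm, frobInner_smul_left, ← mul_assoc,
    Real.sqrt_mul (mul_self_nonneg c), Real.sqrt_mul_self_eq_abs, frobNorm]

lemma cosSim_noiselessEstimator (G Δ : Matrix (Fin p) (Fin q) ℝ) :
    cosSim (noiselessEstimator G Δ) G = |frobInner G Δ| / frobNorm Δ / frobNorm G := by
  rw [cosSim, noiselessEstimator, frobInner_smul_left, frobNorm_smul, frobInner_comm Δ G,
    mul_assoc, ← abs_mul_abs_self, div_div]
  -- If the directional derivative vanishes, both sides are zero by the convention `x / 0 = 0`.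
  by_cases h : |frobInner G Δ| = 0
  · simp [h]
  · rw [mul_div_mul_left _ _ h]

lemma frobInner_mul_transpose {r : ℕ} (G : Matrix (Fin p) (Fin q) ℝ)
    (A : Matrix (Fin q) (Fin r) ℝ) (R : Matrix (Fin p) (Fin r) ℝ) :
    frobInner G (R * A.transpose) = frobInner (G * A) R := by
  rw [frobInner, frobInner, Matrix.transpose_mul, ← Matrix.mul_assoc, Matrix.trace_mul_comm,
    Matrix.mul_assoc]

lemma frobNorm_mul_transpose {r : ℕ} {A : Matrix (Fin q) (Fin r) ℝ}
    (hA : A.transpose * A = 1) (R : Matrix (Fin p) (Fin r) ℝ) :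
    frobNorm (R * A.transpose) = frobNorm R := by
  rw [frobNorm, frobInner_mul_transpose, Matrix.mul_assoc, hA, Matrix.mul_one, frobNorm]

end Frobenius

/-! ### Closed forms of the two expected cosines -/

section Expectation

variable {p q : ℕ}

lemma map_uncurry_gaussianEntries :
    (gaussianEntries p q).map (fun R (ij : Fin p × Fin q) => R ij.1 ij.2) =
      Measure.pi fun _ => gaussianReal 0 1 := by
  refine (Measure.pi_eq fun s hs => ?_).symm
  rw [Measure.map_apply (by fun_prop) (MeasurableSet.univ_pi hs)]
  have : (fun (R : Fin p → Fin q → ℝ) (ij : Fin p × Fin q) => R ij.1 ij.2) ⁻¹' Set.univ.pi s =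
      Set.univ.pi fun i => Set.univ.pi fun j => s (i, j) := by
    ext R
    simp [Set.mem_pi, Prod.forall]
  rw [this, gaussianEntries, Measure.pi_pi, Fintype.prod_prod_type]
  simp_rw [Measure.pi_pi]

/-- The entries of a matrix as a Euclidean vector. -/
def euclideanEntries (R : Fin p → Fin q → ℝ) : EuclideanSpace ℝ (Fin p × Fin q) :=
  WithLp.toLp 2 fun ij => R ij.1 ij.2

lemma measurePreserving_euclideanEntries :
    MeasurePreserving euclideanEntries (gaussianEntries p q)
      (stdGaussian (EuclideanSpace ℝ (Fin p × Fin q))) := by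
  have hm : Measurable (fun (R : Fin p → Fin q → ℝ) (ij : Fin p × Fin q) => R ij.1 ij.2) := by
    fun_prop
  have hl : Measurable (WithLp.toLp 2 : ((Fin p × Fin q) → ℝ) → _) :=
    WithLp.measurable_toLp 2 _
  refine ⟨hl.comp hm, ?_⟩
  rw [← map_pi_eq_stdGaussian, ← map_uncurry_gaussianEntries, Measure.map_map hl hm]
  rfl

lemma inner_euclideanEntries (X Y : Fin p → Fin q → ℝ) :
    inner ℝ (euclideanEntries X) (euclideanEntries Y) =
      frobInner (Matrix.of X) (Matrix.of Y) := by
  simp [euclideanEntries, frobInner_eq_sum, PiLp.inner_apply, mul_comm]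

lemma norm_euclideanEntries (X : Fin p → Fin q → ℝ) :
    ‖euclideanEntries X‖ = frobNorm (Matrix.of X) := by
  rw [frobNorm, ← inner_euclideanEntries, norm_eq_sqrt_real_inner]

lemma integrable_abs_frobInner_div_frobNorm (K : Matrix (Fin p) (Fin q) ℝ) :
    Integrable (fun R => |frobInner K (Matrix.of R)| / frobNorm (Matrix.of R))
      (gaussianEntries p q) := by
  have h := measurePreserving_euclideanEntries.integrable_comp_of_integrable
    (integrable_abs_inner_div_norm (euclideanEntries K))
  have hK (R) : inner ℝ (euclideanEntries K) (euclideanEntries R) = frobInner K (Matrix.of R) :=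
    inner_euclideanEntries K R
  simpa only [Function.comp_def, hK, norm_euclideanEntries] using h

lemma integral_abs_frobInner_div_frobNorm_mul_meanNorm (K : Matrix (Fin p) (Fin q) ℝ) :
    (∫ R, |frobInner K (Matrix.of R)| / frobNorm (Matrix.of R) ∂(gaussianEntries p q)) *
      meanNorm (p * q) = frobNorm K * meanAbs := by
  have h := integral_abs_inner_div_norm_mul_meanNorm (euclideanEntries K)
  rw [← measurePreserving_euclideanEntries.map_eq,
    integral_map measurePreserving_euclideanEntries.aemeasurable
      (Measurable.aestronglyMeasurable (by fun_prop))] at h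
  have hK (R) : inner ℝ (euclideanEntries K) (euclideanEntries R) = frobInner K (Matrix.of R) :=
    inner_euclideanEntries K R
  have hn : ‖euclideanEntries K‖ = frobNorm K := norm_euclideanEntries K
  simpa [hK, hn, norm_euclideanEntries] using h

lemma integrable_cosSim_mezoEstimator (G : Matrix (Fin p) (Fin q) ℝ) :
    Integrable (fun R => cosSim (mezoEstimator G (Matrix.of R)) G) (gaussianEntries p q) := by
  simp_rw [mezoEstimator, cosSim_noiselessEstimator]
  exact (integrable_abs_frobInner_div_frobNorm G).div_const _

lemma integrable_cosSim_agzoEstimator {r : ℕ} (G : Matrix (Fin p) (Fin q) ℝ)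
    {A : Matrix (Fin q) (Fin r) ℝ} (hA : A.transpose * A = 1) :
    Integrable (fun R => cosSim (agzoEstimator G A (Matrix.of R)) G) (gaussianEntries p r) := by
  simp_rw [agzoEstimator, cosSim_noiselessEstimator, frobInner_mul_transpose,
    frobNorm_mul_transpose hA]
  exact (integrable_abs_frobInner_div_frobNorm (G * A)).div_const _

lemma mezoExpectedCos_eq {G : Matrix (Fin p) (Fin q) ℝ} (hG : G ≠ 0) (hpq : 1 ≤ p * q) :
    mezoExpectedCos G = meanAbs / meanNorm (p * q) := by
  have h := integral_abs_frobInner_div_frobNorm_mul_meanNorm G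
  rw [← eq_div_iff (meanNorm_pos hpq).ne'] at h
  simp_rw [mezoExpectedCos, mezoEstimator, cosSim_noiselessEstimator]
  rw [integral_div, h]
  have := (frobNorm_pos hG).ne'
  field_simp

lemma agzoExpectedCos_eq {r : ℕ} (G : Matrix (Fin p) (Fin q) ℝ) {A : Matrix (Fin q) (Fin r) ℝ}
    (hA : A.transpose * A = 1) (hpr : 1 ≤ p * r) :
    agzoExpectedCos G A =
      √(frobInner (G * A) (G * A) / frobInner G G) * (meanAbs / meanNorm (p * r)) := by
  have h := integral_abs_frobInner_div_frobNorm_mul_meanNorm (G * A)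
  rw [← eq_div_iff (meanNorm_pos hpr).ne'] at h
  simp_rw [agzoExpectedCos, agzoEstimator, cosSim_noiselessEstimator, frobInner_mul_transpose,
    frobNorm_mul_transpose hA]
  rw [integral_div, h, Real.sqrt_div (frobInner_self_nonneg _), frobNorm, frobNorm]
  ring

end Expectation

/-! ### Gradient energy in the singular basis -/

section Energy

variable {dout din m s r : ℕ} {Q : Matrix (Fin dout) (Fin m) ℝ} {H : Matrix (Fin din) (Fin m) ℝ}
  {U : Matrix (Fin din) (Fin s) ℝ} {σ : Fin s → ℝ} {V : Matrix (Fin m) (Fin s) ℝ}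

lemma transpose_firstCols_mul_self (hU : U.transpose * U = 1) (hrs : r ≤ s) :
    (firstCols U hrs).transpose * firstCols U hrs = 1 := by
  have h : (firstCols U hrs).transpose * firstCols U hrs =
      (U.transpose * U).submatrix (Fin.castLE hrs) (Fin.castLE hrs) := rfl
  rw [h, hU, Matrix.submatrix_one _ (Fin.castLE_injective hrs)]

lemma interaction_diag (i : Fin s) :
    interaction Q V i i = ∑ k, (Q * V) k i ^ 2 := by
  have h : interaction Q V = (Q * V).transpose * (Q * V) := by
    rw [interaction, Matrix.transpose_mul]
    simp only [Matrix.mul_assoc]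
  rw [h, Matrix.mul_apply]
  simp [sq]

lemma interaction_diag_nonneg (i : Fin s) : 0 ≤ interaction Q V i i := by
  rw [interaction_diag]
  positivity

lemma gradient_mul_left (hH : IsCompactSVD H U σ V) :
    Q * H.transpose * U = Q * V * Matrix.diagonal σ := by
  rw [hH.eq]
  simp only [Matrix.transpose_mul, Matrix.transpose_transpose, Matrix.diagonal_transpose,
    Matrix.mul_assoc, hH.left_orthonormal, Matrix.mul_one]

lemma frobInner_gradient_mul_firstCols (hH : IsCompactSVD H U σ V) (hrs : r ≤ s) :
    frobInner (Q * H.transpose * firstCols U hrs) (Q * H.transpose * firstCols U hrs) =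
      ∑ i : Fin r, interaction Q V (Fin.castLE hrs i) (Fin.castLE hrs i) *
        σ (Fin.castLE hrs i) ^ 2 := by
  have h (i : Fin dout) (j : Fin r) : (Q * H.transpose * firstCols U hrs) i j =
      (Q * V) i (Fin.castLE hrs j) * σ (Fin.castLE hrs j) := by
    have h1 : (Q * H.transpose * firstCols U hrs) i j =
      (Q * H.transpose * U) i (Fin.castLE hrs j) := rfl
    rw [h1, gradient_mul_left hH, Matrix.mul_diagonal]
  rw [frobInner_eq_sum, Fintype.sum_prod_type, Finset.sum_comm]
  refine Finset.sum_congr rfl fun j _ => ?_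
  rw [interaction_diag, Finset.sum_mul]
  refine Finset.sum_congr rfl fun i _ => ?_
  rw [h]
  ring

lemma frobInner_gradient (hH : IsCompactSVD H U σ V) :
    frobInner (Q * H.transpose) (Q * H.transpose) = ∑ i, interaction Q V i i * σ i ^ 2 := by
  have h := frobInner_gradient_mul_firstCols (Q := Q) hH le_rfl
  have hU : firstCols U le_rfl = U := rfl
  -- The rows of the gradient lie in the column span of `U`, so projecting onto that span loses no
  -- energy.
  have hG : Q * H.transpose * U * U.transpose = Q * H.transpose := by
    rw [gradient_mul_left hH, hH.eq]
    simp only [Matrix.transpose_mul, Matrix.transpose_transpose, Matrix.diagonal_transpose,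
      Matrix.mul_assoc]
  rw [hU, ← frobInner_mul_transpose, hG] at h
  exact h

end Energy

end AGZO

namespace AGZO

/-! ### Lower bound and monotonicity of the energy share -/

section EnergyShare

variable {s r : ℕ}

/-- The part of a sum over `Fin s` that runs over the indices from `r` on. -/
def tailSum (r : ℕ) (f : Fin s → ℝ) : ℝ := ∑ i ∈ Finset.univ.filter fun i : Fin s => r ≤ (i : ℕ), f i

lemma sum_castLE_eq_sum_filter (hrs : r ≤ s) (f : Fin s → ℝ) :
    ∑ i : Fin r, f (Fin.castLE hrs i) =
      ∑ i ∈ Finset.univ.filter fun i : Fin s => (i : ℕ) < r, f i :=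
  Finset.sum_bij (fun i _ => Fin.castLE hrs i) (by simp)
    (fun _ _ _ _ h => Fin.castLE_injective hrs h)
    (fun j hj => ⟨⟨j, by simpa using hj⟩, Finset.mem_univ _, rfl⟩) fun _ _ => rfl

lemma sum_castLE_add_tailSum (hrs : r ≤ s) (f : Fin s → ℝ) :
    ∑ i : Fin r, f (Fin.castLE hrs i) + tailSum r f = ∑ i, f i := by
  rw [sum_castLE_eq_sum_filter, tailSum,
    ← Finset.sum_filter_add_sum_filter_not Finset.univ fun i : Fin s => (i : ℕ) < r]
  simp only [not_lt]

lemma tailSum_nonneg {f : Fin s → ℝ} (hf : ∀ i, 0 ≤ f i) : 0 ≤ tailSum r f :=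
  Finset.sum_nonneg fun i _ => hf i

variable {B : Matrix (Fin s) (Fin s) ℝ} {σ τ : Fin s → ℝ}

/-- Indices start at zero, so `k ≤ r` admits both the last head index `r - 1` and the first tail
index `r`; the strict bound needs the latter. -/
lemma mul_tailSum_le_of_antitone (hB : ∀ i, 0 ≤ B i i) (hpos : ∀ i, 0 < σ i) (hσ : Antitone σ)
    {k : Fin s} (hk : (k : ℕ) ≤ r) :
    tailSum r (fun i => B i i * σ i ^ 2) ≤ σ k ^ 2 * tailSum r fun i => B i i := by
  rw [tailSum, tailSum, Finset.mul_sum]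
  refine Finset.sum_le_sum fun i hi => ?_
  rw [mul_comm]
  refine mul_le_mul_of_nonneg_right ?_ (hB i)
  exact pow_le_pow_left₀ (hpos i).le (hσ (Fin.le_def.2 (hk.trans (by simpa using hi)))) 2

lemma mul_headSum_le_of_antitone (hB : ∀ i, 0 ≤ B i i) (hpos : ∀ i, 0 < σ i) (hσ : Antitone σ)
    (hrs : r ≤ s) {k : Fin s} (hk : r ≤ (k : ℕ) + 1) :
    σ k ^ 2 * ∑ i : Fin r, B (Fin.castLE hrs i) (Fin.castLE hrs i) ≤
      ∑ i : Fin r, B (Fin.castLE hrs i) (Fin.castLE hrs i) * σ (Fin.castLE hrs i) ^ 2 := by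
  rw [Finset.mul_sum]
  refine Finset.sum_le_sum fun i _ => ?_
  rw [mul_comm]
  refine mul_le_mul_of_nonneg_left ?_ (hB _)
  refine pow_le_pow_left₀ (hpos k).le (hσ (Fin.le_def.2 ?_)) 2
  simp only [Fin.val_castLE]
  omega

lemma mul_tailSum_le_of_mean_le (hr : 1 ≤ r) (hrs : r ≤ s)
    (hmean : (1 / (s : ℝ)) * ∑ i : Fin s, B i i ≤
      (1 / (r : ℝ)) * ∑ i : Fin r, B (Fin.castLE hrs i) (Fin.castLE hrs i)) :
    (r : ℝ) * tailSum r (fun i => B i i) ≤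
      ((s : ℝ) - r) * ∑ i : Fin r, B (Fin.castLE hrs i) (Fin.castLE hrs i) := by
  have hr0 : (0 : ℝ) < r := by exact_mod_cast hr
  have hs0 : (0 : ℝ) < s := by exact_mod_cast hr.trans hrs
  rw [← sum_castLE_add_tailSum hrs fun i => B i i, one_div_mul_eq_div, one_div_mul_eq_div,
    div_le_div_iff₀ hs0 hr0] at hmean
  linarith

/-- The value `σ k ^ 2` at the last head index separates head weights from tail weights. It reduces
the claim to the case of constant weights, which is the mean hypothesis. -/
lemma div_le_energyShare (hB : ∀ i, 0 ≤ B i i) (hpos : ∀ i, 0 < σ i) (hσ : Antitone σ)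
    (hr : 1 ≤ r) (hrs : r ≤ s) (htot : 0 < ∑ i, B i i * σ i ^ 2)
    (hmean : (1 / (s : ℝ)) * ∑ i : Fin s, B i i ≤
      (1 / (r : ℝ)) * ∑ i : Fin r, B (Fin.castLE hrs i) (Fin.castLE hrs i)) :
    (r : ℝ) / s ≤ energyShare B σ hrs := by
  have hs0 : (0 : ℝ) < s := by exact_mod_cast hr.trans hrs
  have hsr : (0 : ℝ) ≤ (s : ℝ) - r := by
    rw [sub_nonneg]
    exact_mod_cast hrs
  let k : Fin s := ⟨r - 1, by omega⟩
  have hT := mul_tailSum_le_of_antitone hB hpos hσ (k := k) (Nat.sub_le r 1)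
  have hN := mul_headSum_le_of_antitone hB hpos hσ hrs (k := k) (by simp only [k]; omega)
  have hm := mul_tailSum_le_of_mean_le hr hrs hmean
  rw [energyShare, div_le_div_iff₀ hs0 htot, ← sum_castLE_add_tailSum hrs]
  have h1 := mul_le_mul_of_nonneg_left hT (Nat.cast_nonneg (α := ℝ) r)
  have h2 := mul_le_mul_of_nonneg_left hN hsr
  have h3 := mul_le_mul_of_nonneg_left hm (sq_nonneg (σ k))
  linarith

lemma div_lt_energyShare (hB : ∀ i, 0 ≤ B i i) (hpos : ∀ i, 0 < σ i) (hσ : Antitone σ)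
    (hr : 1 ≤ r) (hrs : r < s) (htot : 0 < ∑ i, B i i * σ i ^ 2)
    (hgap : ∀ i j : Fin s, (i : ℕ) < r → r ≤ (j : ℕ) → σ j < σ i)
    (hmean : (1 / (s : ℝ)) * ∑ i : Fin s, B i i ≤
      (1 / (r : ℝ)) * ∑ i : Fin r, B (Fin.castLE hrs.le i) (Fin.castLE hrs.le i)) :
    (r : ℝ) / s < energyShare B σ hrs.le := by
  have hs0 : (0 : ℝ) < s := by exact_mod_cast hr.trans hrs.le
  have hr0 : (0 : ℝ) < r := by exact_mod_cast hr
  have hsr : (0 : ℝ) < (s : ℝ) - r := by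
    rw [sub_pos]
    exact_mod_cast hrs
  let k : Fin s := ⟨r - 1, by omega⟩
  let l : Fin s := ⟨r, hrs⟩
  have hkl : σ l ^ 2 < σ k ^ 2 :=
    pow_lt_pow_left₀ (hgap k l (by simp only [k]; omega) le_rfl) (hpos l).le two_ne_zero
  have hT := mul_tailSum_le_of_antitone hB hpos hσ (k := l) le_rfl
  have hN := mul_headSum_le_of_antitone hB hpos hσ hrs.le (k := k) (by simp only [k]; omega)
  have hm := mul_tailSum_le_of_mean_le hr hrs.le hmean
  have hBt : 0 ≤ tailSum r fun i => B i i := tailSum_nonneg hB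
  have h2 := mul_le_mul_of_nonneg_left hN hsr.le
  have h3 := mul_le_mul_of_nonneg_left hm (sq_nonneg (σ k))
  rw [← sum_castLE_add_tailSum hrs.le] at htot
  rw [energyShare, ← sum_castLE_add_tailSum hrs.le, div_lt_div_iff₀ hs0 htot]
  suffices h : (r : ℝ) * tailSum r (fun i => B i i * σ i ^ 2) <
      ((s : ℝ) - r) * ∑ i : Fin r, B (Fin.castLE hrs.le i) (Fin.castLE hrs.le i) *
        σ (Fin.castLE hrs.le i) ^ 2 by linarith
  -- If the tail of `B` vanishes, the share is `1 > r / s`; otherwise strictness comes from `σ l < σ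
  -- k`.
  rcases hBt.eq_or_lt with h0 | h0
  · have hT0 : tailSum r (fun i => B i i * σ i ^ 2) = 0 :=
      le_antisymm (hT.trans_eq (by rw [← h0, mul_zero]))
        (tailSum_nonneg fun i => mul_nonneg (hB i) (sq_nonneg _))
    rw [hT0, add_zero] at htot
    rw [hT0, mul_zero]
    exact mul_pos hsr htot
  · have h1 := mul_le_mul_of_nonneg_left hT hr0.le
    have h4 := mul_lt_mul_of_pos_right hkl (mul_pos hr0 h0)
    linarith

lemma headSum_mul_tailSum (hrs : r ≤ s) (f g : Fin s → ℝ) :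
    (∑ i : Fin r, f (Fin.castLE hrs i)) * tailSum r g =
      ∑ p ∈ (Finset.univ.filter fun i : Fin s => (i : ℕ) < r) ×ˢ
        (Finset.univ.filter fun j : Fin s => r ≤ (j : ℕ)), f p.1 * g p.2 := by
  rw [sum_castLE_eq_sum_filter, tailSum, Finset.sum_mul_sum, Finset.sum_product]

/-- After cross-multiplication the head-times-head products agree and cancel. -/
lemma energyShare_le_iff (hrs : r ≤ s) (hσ : 0 < ∑ i, B i i * σ i ^ 2)
    (hτ : 0 < ∑ i, B i i * τ i ^ 2) :
    energyShare B σ hrs ≤ energyShare B τ hrs ↔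
      (∑ i : Fin r, B (Fin.castLE hrs i) (Fin.castLE hrs i) * σ (Fin.castLE hrs i) ^ 2) *
          tailSum r (fun i => B i i * τ i ^ 2) ≤
        (∑ i : Fin r, B (Fin.castLE hrs i) (Fin.castLE hrs i) * τ (Fin.castLE hrs i) ^ 2) *
          tailSum r (fun i => B i i * σ i ^ 2) := by
  rw [energyShare, energyShare, div_le_div_iff₀ hσ hτ, ← sum_castLE_add_tailSum hrs,
    ← sum_castLE_add_tailSum hrs fun i => B i i * σ i ^ 2, mul_add, mul_add, mul_comm
    (∑ i : Fin r, B (Fin.castLE hrs i) (Fin.castLE hrs i) * σ (Fin.castLE hrs i) ^ 2),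
    add_le_add_iff_left, mul_comm (∑ i : Fin r, _)]

lemma cross_le (hB : ∀ i, 0 ≤ B i i) (hσ : ∀ i, 0 < σ i) (hτ : ∀ i, 0 < τ i) {i j : Fin s}
    (h : τ j / τ i ≤ σ j / σ i) :
    B i i * σ i ^ 2 * (B j j * τ j ^ 2) ≤ B i i * τ i ^ 2 * (B j j * σ j ^ 2) := by
  rw [div_le_div_iff₀ (hτ i) (hσ i)] at h
  have h2 := pow_le_pow_left₀ (mul_pos (hτ j) (hσ i)).le h 2
  have h3 := mul_le_mul_of_nonneg_left h2 (mul_nonneg (hB i) (hB j))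
  linarith

lemma cross_lt (hσ : ∀ i, 0 < σ i) (hτ : ∀ i, 0 < τ i) {i j : Fin s} (hi : 0 < B i i)
    (hj : 0 < B j j) (h : τ j / τ i < σ j / σ i) :
    B i i * σ i ^ 2 * (B j j * τ j ^ 2) < B i i * τ i ^ 2 * (B j j * σ j ^ 2) := by
  rw [div_lt_div_iff₀ (hτ i) (hσ i)] at h
  have h2 := pow_lt_pow_left₀ h (mul_pos (hτ j) (hσ i)).le two_ne_zero
  have h3 := mul_lt_mul_of_pos_left h2 (mul_pos hi hj)
  linarith

/-- Expanding head times tail as a double sum over `i < r ≤ j` makes the inequality hold term by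
term, each term being a squared ratio comparison. -/
lemma energyShare_mono (hB : ∀ i, 0 ≤ B i i) (hσ : ∀ i, 0 < σ i) (hτ : ∀ i, 0 < τ i)
    (hrs : r ≤ s) (hσ0 : 0 < ∑ i, B i i * σ i ^ 2) (hτ0 : 0 < ∑ i, B i i * τ i ^ 2)
    (h : DecaysFaster τ σ) : energyShare B σ hrs ≤ energyShare B τ hrs := by
  rw [energyShare_le_iff hrs hσ0 hτ0, headSum_mul_tailSum hrs fun i => B i i * σ i ^ 2,
    headSum_mul_tailSum hrs fun i => B i i * τ i ^ 2]
  refine Finset.sum_le_sum fun p hp => cross_le hB hσ hτ (h _ _ (Fin.le_def.2 ?_))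
  simp only [Finset.mem_product, Finset.mem_filter, Finset.mem_univ, true_and] at hp
  omega

lemma energyShare_strictMono (hB : ∀ i, 0 ≤ B i i) (hσ : ∀ i, 0 < σ i) (hτ : ∀ i, 0 < τ i)
    (hrs : r ≤ s) (hσ0 : 0 < ∑ i, B i i * σ i ^ 2) (hτ0 : 0 < ∑ i, B i i * τ i ^ 2)
    (h : DecaysFaster τ σ) (hlt : ∃ i j : Fin s, (i : ℕ) < r ∧ r ≤ (j : ℕ) ∧
      0 < B i i ∧ 0 < B j j ∧ τ j / τ i < σ j / σ i) :
    energyShare B σ hrs < energyShare B τ hrs := by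
  obtain ⟨i, j, hi, hj, hBi, hBj, hij⟩ := hlt
  rw [← not_le, energyShare_le_iff hrs hτ0 hσ0, not_le,
    headSum_mul_tailSum hrs fun i => B i i * σ i ^ 2,
    headSum_mul_tailSum hrs fun i => B i i * τ i ^ 2]
  refine Finset.sum_lt_sum (fun p hp => cross_le hB hσ hτ (h _ _ (Fin.le_def.2 ?_)))
    ⟨(i, j), by simp [hi, hj], cross_lt hσ hτ hBi hBj hij⟩
  simp only [Finset.mem_product, Finset.mem_filter, Finset.mem_univ, true_and] at hp
  omega

end EnergyShare

/-! ### Comparison of the two estimators -/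

section Comparison

variable {dout din m s r : ℕ} {Q : Matrix (Fin dout) (Fin m) ℝ} {H : Matrix (Fin din) (Fin m) ℝ}
  {U : Matrix (Fin din) (Fin s) ℝ} {σ : Fin s → ℝ} {V : Matrix (Fin m) (Fin s) ℝ}

lemma agzoExpectedCos_eq_energyShare (hH : IsCompactSVD H U σ V) (hrs : r ≤ s)
    (hdr : 1 ≤ dout * r) :
    agzoExpectedCos (Q * H.transpose) (firstCols U hrs) =
      √(energyShare (interaction Q V) σ hrs) * (meanAbs / meanNorm (dout * r)) := by
  rw [agzoExpectedCos_eq _ (transpose_firstCols_mul_self hH.left_orthonormal hrs) hdr,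
    frobInner_gradient_mul_firstCols hH, frobInner_gradient hH, energyShare]

lemma energy_pos (hH : IsCompactSVD H U σ V) (hG : Q * H.transpose ≠ 0) :
    0 < ∑ i, interaction Q V i i * σ i ^ 2 := by
  rw [← frobInner_gradient hH]
  exact frobInner_self_pos hG

lemma gradient_ne_zero_of_energy_pos (hH : IsCompactSVD H U σ V)
    (h : 0 < ∑ i, interaction Q V i i * σ i ^ 2) : Q * H.transpose ≠ 0 := by
  intro h0
  rw [← frobInner_gradient hH, h0] at h
  simp [frobInner] at h

/-- With positive weights the energy vanishes only if every `B i i` does, a condition free of the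
singular values; hence the modified gradient is nonzero too. -/
lemma energy_pos_congr {τ : Fin s → ℝ} (hτ : ∀ i, 0 < τ i)
    (h : 0 < ∑ i, interaction Q V i i * σ i ^ 2) :
    0 < ∑ i, interaction Q V i i * τ i ^ 2 := by
  have hn (i : Fin s) : 0 ≤ interaction Q V i i * τ i ^ 2 :=
    mul_nonneg (interaction_diag_nonneg i) (sq_nonneg _)
  refine lt_of_le_of_ne (Finset.sum_nonneg fun i _ => hn i) fun h0 => h.ne' ?_
  rw [eq_comm, Finset.sum_eq_zero_iff_of_nonneg fun i _ => hn i] at h0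
  refine Finset.sum_eq_zero fun i hi => ?_
  have h1 := h0 i hi
  rw [mul_eq_zero, or_iff_left (pow_ne_zero 2 (hτ i).ne')] at h1
  rw [h1, zero_mul]

lemma meanAbs_div_meanNorm_lt {d n : ℕ} (hd : 1 ≤ d) (hr : 1 ≤ r) (hrs : r ≤ s) (hs : s < n)
    {ρ : ℝ} (hρ : (r : ℝ) / s ≤ ρ) :
    meanAbs / meanNorm (d * n) < √ρ * (meanAbs / meanNorm (d * r)) := by
  have hd0 : (0 : ℝ) < d := by exact_mod_cast hd
  have hr0 : (0 : ℝ) < r := by exact_mod_cast hr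
  have hs0 : (0 : ℝ) < s := by exact_mod_cast hr.trans hrs
  have hdr : 1 ≤ d * r := Nat.mul_pos hd hr
  have hds : d * r ≤ d * s := Nat.mul_le_mul_left d hrs
  have hmr := meanNorm_pos hdr
  have hms := meanNorm_pos (hdr.trans hds)
  have h1 : meanAbs / meanNorm (d * n) < meanAbs / meanNorm (d * s) :=
    div_lt_div_of_pos_left meanAbs_pos hms
      (meanNorm_strictMono (hdr.trans hds) (Nat.mul_lt_mul_of_pos_left hs hd))
  have h2 := meanNorm_div_sqrt_mono hdr hds
  push_cast at h2
  rw [div_le_div_iff₀ (by positivity) (by positivity), Real.sqrt_mul hd0.le,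
    Real.sqrt_mul hd0.le] at h2
  -- The common factor `√d` cancels from the comparison of dimensions `d * r` and `d * s`.
  have h3 : meanNorm (d * r) * √s ≤ meanNorm (d * s) * √r :=
    le_of_mul_le_mul_left (by linarith) (Real.sqrt_pos.2 hd0)
  have h4 : meanAbs / meanNorm (d * s) ≤ √((r : ℝ) / s) * (meanAbs / meanNorm (d * r)) := by
    rw [Real.sqrt_div hr0.le, div_mul_div_comm, div_le_div_iff₀ hms (by positivity)]
    have := mul_le_mul_of_nonneg_left h3 meanAbs_pos.le
    linarith
  exact h1.trans_le (h4.trans (mul_le_mul_of_nonneg_right (Real.sqrt_le_sqrt hρ)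
    (div_pos meanAbs_pos hmr).le))

lemma div_sub_one_div_le_div (hd : 1 ≤ dout) (hr : 1 ≤ r) (hrs : r ≤ s) (hs : s < din) :
    (r : ℝ) / ((din : ℝ) - 1 / (dout : ℝ)) ≤ (r : ℝ) / s := by
  have hs0 : (0 : ℝ) < s := by exact_mod_cast hr.trans hrs
  refine div_le_div_of_nonneg_left (Nat.cast_nonneg r) hs0 ?_
  have h1 : 1 / (dout : ℝ) ≤ 1 := (div_le_one₀ (by exact_mod_cast hd)).2 (by exact_mod_cast hd)
  have h2 : (s : ℝ) + 1 ≤ din := by exact_mod_cast hs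
  linarith

end Comparison

end AGZO

theorem theorem3 {dout din m s r : ℕ}
    (Q : Matrix (Fin dout) (Fin m) ℝ) (H : Matrix (Fin din) (Fin m) ℝ)
    (U : Matrix (Fin din) (Fin s) ℝ) (σ : Fin s → ℝ) (V : Matrix (Fin m) (Fin s) ℝ)
    (hH : AGZO.IsCompactSVD H U σ V)
    (hs : s < din) (hr : 1 ≤ r) (hrs : r ≤ s)
    (hG : Q * H.transpose ≠ 0)
    (hB : (1 / (s : ℝ)) * ∑ i : Fin s, AGZO.interaction Q V i i ≤
      (1 / (r : ℝ)) * ∑ i : Fin r,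
        AGZO.interaction Q V (Fin.castLE hrs i) (Fin.castLE hrs i)) :
    -- energy captured by the leading directions
    ((r : ℝ) / s ≤ AGZO.energyShare (AGZO.interaction Q V) σ hrs ∧
      (r < s → (∀ i j : Fin s, (i : ℕ) < r → r ≤ (j : ℕ) → σ j < σ i) →
        (r : ℝ) / s < AGZO.energyShare (AGZO.interaction Q V) σ hrs) ∧
      (r : ℝ) / ((din : ℝ) - 1 / (dout : ℝ)) ≤ (r : ℝ) / s) ∧
    -- the two expectations are genuine integrals
    MeasureTheory.Integrable
      (fun R => AGZO.cosSim
        (AGZO.agzoEstimator (Q * H.transpose) (AGZO.firstCols U hrs) (Matrix.of R))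
        (Q * H.transpose)) (AGZO.gaussianEntries dout r) ∧
    MeasureTheory.Integrable
      (fun R => AGZO.cosSim (AGZO.mezoEstimator (Q * H.transpose) (Matrix.of R))
        (Q * H.transpose)) (AGZO.gaussianEntries dout din) ∧
    -- AGZO beats MeZO
    AGZO.mezoExpectedCos (Q * H.transpose) <
      AGZO.agzoExpectedCos (Q * H.transpose) (AGZO.firstCols U hrs) ∧
    -- the gap widens with the heterogeneity of the singular values
    (∀ (H' : Matrix (Fin din) (Fin m) ℝ) (τ : Fin s → ℝ),
      AGZO.IsCompactSVD H' U τ V → AGZO.DecaysFaster τ σ →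
        AGZO.cosGap (Q * H.transpose) (AGZO.firstCols U hrs) ≤
          AGZO.cosGap (Q * H'.transpose) (AGZO.firstCols U hrs) ∧
        ((∃ i j : Fin s, (i : ℕ) < r ∧ r ≤ (j : ℕ) ∧
            0 < AGZO.interaction Q V i i ∧ 0 < AGZO.interaction Q V j j ∧
            τ j / τ i < σ j / σ i) →
          AGZO.cosGap (Q * H.transpose) (AGZO.firstCols U hrs) <
            AGZO.cosGap (Q * H'.transpose) (AGZO.firstCols U hrs))) := by
  have hd : 1 ≤ dout := by
    rw [Nat.one_le_iff_ne_zero]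
    rintro rfl
    exact hG (Matrix.ext fun i => i.elim0)
  have hdr : 1 ≤ dout * r := Nat.mul_pos hd hr
  have hdd : 1 ≤ dout * din := Nat.mul_pos hd (by omega)
  have hB0 : ∀ i, 0 ≤ AGZO.interaction Q V i i := AGZO.interaction_diag_nonneg
  have hE := AGZO.energy_pos hH hG
  have hshare := AGZO.div_le_energyShare hB0 hH.pos hH.anti hr hrs hE hB
  refine ⟨⟨hshare, fun hlt hgap => AGZO.div_lt_energyShare hB0 hH.pos hH.anti hr hlt hE hgap hB,
    AGZO.div_sub_one_div_le_div hd hr hrs hs⟩,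
    AGZO.integrable_cosSim_agzoEstimator _
      (AGZO.transpose_firstCols_mul_self hH.left_orthonormal hrs),
    AGZO.integrable_cosSim_mezoEstimator _, ?_, fun H' τ hH' hdec => ?_⟩
  · rw [AGZO.mezoExpectedCos_eq hG hdd, AGZO.agzoExpectedCos_eq_energyShare hH hrs hdr]
    exact AGZO.meanAbs_div_meanNorm_lt hd hr hrs hs hshare
  · have hE' := AGZO.energy_pos_congr hH'.pos hE
    have hc := div_pos AGZO.meanAbs_pos (AGZO.meanNorm_pos hdr)
    rw [AGZO.cosGap, AGZO.cosGap, AGZO.mezoExpectedCos_eq hG hdd,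
      AGZO.mezoExpectedCos_eq (AGZO.gradient_ne_zero_of_energy_pos hH' hE') hdd,
      AGZO.agzoExpectedCos_eq_energyShare hH hrs hdr,
      AGZO.agzoExpectedCos_eq_energyShare hH' hrs hdr, sub_le_sub_iff_right, sub_lt_sub_iff_right,
      mul_le_mul_iff_left₀ hc, mul_lt_mul_iff_left₀ hc]
    refine ⟨Real.sqrt_le_sqrt (AGZO.energyShare_mono hB0 hH.pos hH'.pos hrs hE hE' hdec),
      -- Strict monotonicity of the square root needs a nonnegative smaller share, supplied by the
      -- bound `r / s`.
      fun hlt => Real.sqrt_lt_sqrt ((by positivity : (0 : ℝ) ≤ (r : ℝ) / s).trans hshare)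
        (AGZO.energyShare_strictMono hB0 hH.pos hH'.pos hrs hE hE' hdec hlt)⟩
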